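/- A crossed module is a homomorphism of groups $\partial\colon C\to G$ together with an action $(x,c)\mapsto {}^xc$ of $G$ on $C$ by group automorphisms such that $\partial({}^xc)=x\,\partial(c)\,x^{-1}$ and $aba^{-1}={}^{\partial a}b$ for all $x\in G$, $a,b,c\in C$. It is free on a map $\varphi\colon Y\to C$ if, for every crossed module $\delta\colon D\to H$, every homomorphism $\alpha\colon G\to H$ and every map $b\colon Y\to D$ with $\alpha\circ\partial\circ\varphi=\delta\circ b$, there is a unique homomorphism $\beta\colon C\to D$ with $\beta\circ\varphi=b$ such that $(\beta,\alpha)$ is a morphism of crossed modules. For a subset $S\subseteq G$, the free crossed module on $S$ is the one free on a map $\varphi\colon S\to C$ with $\partial\varphi(s)=s$ for all $s\in S$. Let $\mathrm H_2(G)$ be the second integral homology group of $G$. For an abelian group $A$ with trivial $G$-action, the universal coefficient map $\mathrm H^2(G,A)\to\mathrm{Hom}(\mathrm H_2(G),A)$ sends the class of a $2$-cocycle $f$ to the homomorphism $[\sum_i n_i(g_i,h_i)]\mapsto\sum_i n_i f(g_i,h_i)$. A central extension $0\to A\to E\to G\to 1$ has as its class $[\mathbf e]\in \mathrm H^2(G,A)$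 the class of the cocycle $f$ with $\sigma(g)\sigma(h)=f(g,h)\,\sigma(gh)$, for any set-theoretic section $\sigma$ of $E\to G$. A central extension $0\to \mathrm H_2(G)\to U\to G\to 1$ is called universal if, for every abelian group $A$ and every central extension $\mathbf e\colon 0\to A\to E\to G\to 1$, the identity of $G$ lifts to a morphism of extensions, given by $\vartheta\colon \mathrm H_2(G)\to A$ and $\Theta\colon U\to E$, and the component $\vartheta$ of every such morphism is the image of $[\mathbf e]$ under the universal coefficient map. **Theorem.** (1) Let $G$ be a group, let $S\subseteq G$ be a subset whose normal closure is all of $G$, let $\partial\colon C\to G$ be the free crossed module on $S$, and suppose that the induced map $C_{\mathrm{Ab}}\to G_{\mathrm{Ab}}$ of abelianizations is an isomorphism. Then $\partial$ fits into a central extension $$0\longrightarrow \mathrm H_2(G)\longrightarrow C\xrightarrow{\ \partial\ } G\longrightarrow 1$$ which is universal. (2) In particular, let $n\ge 2$, let $B_n$ be Artin's braid group on $n$ strings, with generators $\sigma_1,\dots,\sigma_{n-1}$ and relations $\sigma_i\sigma_k=\sigma_k\sigma_i$ for $|i-k|\ge 2$ and $\sigma_i\sigma_{i+1}\sigma_i=\sigma_{i+1}\sigma_i\sigma_{i+1}$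 for $1\le i\le n-2$, and let $\partial\colon C_n\to B_n$ be the free crossed module on a single generator $\sigma_j$, $1\le j\le n-1$. Then $\partial$ fits into a central extension $0\to \mathrm H_2(B_n)\to C_n\to B_n\to 1$ which is universal. -/

import Mathlib

universe u

/-- A crossed module `∂ : C → G`: a homomorphism of groups together with an action of `G` on `C` by
group automorphisms, such that `∂` is equivariant (for conjugation on `G`) and the Peiffer
identities `a b a⁻¹ = ^{∂ a} b` hold. -/
structure CrossedModule (C G : Type*) [Group C] [Group G] where
  /-- the action of `G` on `C` by group automorphisms -/
  act : G →* MulAut C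
  /-- the boundary homomorphism `∂` -/
  bd : C →* G
  bd_act : ∀ (x : G) (c : C), bd (act x c) = x * bd c * x⁻¹
  peiffer : ∀ a b : C, a * b * a⁻¹ = act (bd a) b

/-- The pair `(β, α)` is a morphism of crossed modules from `X` to `X'`. -/
def CrossedModule.IsMorphism {C G D H : Type*} [Group C] [Group G] [Group D] [Group H]
    (X : CrossedModule C G) (X' : CrossedModule D H) (β : C →* D) (α : G →* H) : Prop :=
  (∀ c : C, X'.bd (β c) = α (X.bd c)) ∧
    ∀ (x : G) (c : C), β (X.act x c) = X'.act (α x) (β c)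

/-- The crossed module `∂ : C → G` is free on the map `φ : Y → C`: for every crossed module
`δ : D → H`, every homomorphism `α : G → H` and every map `b : Y → D` with `α ∂ φ = δ b`, there is
a unique homomorphism `β : C → D` with `β φ = b` such that `(β, α)` is a morphism of crossed
modules. -/
def CrossedModule.IsFreeOn {C G Y : Type u} [Group C] [Group G]
    (X : CrossedModule C G) (φ : Y → C) : Prop :=
  ∀ (D H : Type u) [Group D] [Group H] (X' : CrossedModule D H) (α : G →* H) (b : Y → D),
    (∀ y : Y, α (X.bd (φ y)) = X'.bd (b y)) →
      ∃! β : C →* D, (∀ y : Y, β (φ y) = b y) ∧ X.IsMorphism X' β α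

namespace CentralExt

/-- The trivial `G`-module `ℤ`. (Mathlib's group homology wants the ring and the group in the same
universe, hence `ULift ℤ`.) -/
noncomputable abbrev intRep (G : Type u) [Group G] : Rep.{u} (ULift.{u} ℤ) G :=
  Rep.trivial (ULift.{u} ℤ) G (ULift.{u} ℤ)

/-- The abelian group `A` as a trivial `G`-module. -/
noncomputable abbrev coeffRep (G A : Type u) [Group G] [AddCommGroup A] :
    Rep.{u} (ULift.{u} ℤ) G :=
  Rep.trivial (ULift.{u} ℤ) G A

/-- The integral second homology group `H₂(G)`. -/
noncomputable abbrev HTwo (G : Type u) [Group G] : Type u :=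
  groupHomology.H2 (intRep G)

/-- The second cohomology group `H²(G, A)` with coefficients in the trivial module `A`. -/
noncomputable abbrev CoHTwo (G A : Type u) [Group G] [AddCommGroup A] : Type u :=
  groupCohomology.H2 (coeffRep G A)

section UniversalCoefficient

variable {G A : Type u} [AddCommGroup A]

/-- Evaluation of a 2-cochain on the bar chains:
`⟨f, ∑ nᵢ (gᵢ, hᵢ)⟩ = ∑ nᵢ f (gᵢ, hᵢ)`. -/
noncomputable def evalChain (f : G × G → A) : (G × G →₀ ULift.{u} ℤ) →+ A :=
  Finsupp.liftAddHom fun p =>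
    (zmultiplesHom A (f p)).comp (AddEquiv.ulift : ULift.{u} ℤ ≃+ ℤ).toAddMonoidHom

theorem evalChain_single (f : G × G → A) (p : G × G) (n : ULift.{u} ℤ) :
    evalChain f (Finsupp.single p n) = n.down • f p := by
  simp [evalChain]
  rfl

theorem evalChain_add (f f' : G × G → A) (z : G × G →₀ ULift.{u} ℤ) :
    evalChain (f + f') z = evalChain f z + evalChain f' z := by
  induction z using Finsupp.induction_linear with
  | zero => simp
  | add x y hx hy => rw [map_add, map_add, map_add, hx, hy]; abel
  | single p n => simp [evalChain_single]

variable [Group G]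

/-- A cocycle vanishes on boundaries. -/
theorem evalChain_boundary (f : groupCohomology.cocycles₂ (coeffRep G A))
    (z : G × G →₀ ULift.{u} ℤ) (hz : z ∈ groupHomology.boundaries₂ (intRep G)) :
    evalChain (f : G × G → A) z = 0 := by
  obtain ⟨y, rfl⟩ := hz
  induction y using Finsupp.induction_linear with
  | zero => rw [map_zero, map_zero]
  | add x y hx hy => rw [map_add, map_add, hx, hy, add_zero]
  | single p n =>
    obtain ⟨g, h, j⟩ := p
    have key : f (h, j) - f (g * h, j) + f (g, h * j) - f (g, h) = (0 : A) :=
      (groupCohomology.mem_cocycles₂_def (A := coeffRep G A) f.1).1 f.2 g h j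
    have e : (groupHomology.d₃₂ (intRep G)).hom (Finsupp.single (g, h, j) n) =
        (Finsupp.single (h, j) n - Finsupp.single (g * h, j) n +
          Finsupp.single (g, h * j) n - Finsupp.single (g, h) n : G × G →₀ ULift.{u} ℤ) :=
      groupHomology.d₃₂_single (A := intRep G) (g, h, j) n
    have e' : evalChain (f : G × G → A) (Finsupp.single (h, j) n - Finsupp.single (g * h, j) n +
          Finsupp.single (g, h * j) n - Finsupp.single (g, h) n : G × G →₀ ULift.{u} ℤ) = 0 := by
      rw [map_sub, map_add, map_sub]
      simp only [evalChain_single]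
      rw [← smul_sub, ← smul_add, ← smul_sub, key, smul_zero]
    exact (congrArg _ e).trans e'

/-- The coboundary of `x` evaluated on a chain is `x` evaluated on the boundary of the chain. -/
theorem evalChain_d (x : G → A) (z : G × G →₀ ULift.{u} ℤ) :
    evalChain (fun p : G × G => x p.2 - x (p.1 * p.2) + x p.1) z =
      (Finsupp.liftAddHom fun g => (zmultiplesHom A (x g)).comp
        (AddEquiv.ulift : ULift.{u} ℤ ≃+ ℤ).toAddMonoidHom :
          (G →₀ ULift.{u} ℤ) →+ A) ((groupHomology.d₂₁ (intRep G)).hom z) := by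
  induction z using Finsupp.induction_linear with
  | zero => rw [map_zero, map_zero, map_zero]
  | add y z hy hz => rw [map_add, map_add, map_add, hy, hz]
  | single p n =>
    have e : (groupHomology.d₂₁ (intRep G)).hom (Finsupp.single p n) =
        (Finsupp.single p.2 n - Finsupp.single (p.1 * p.2) n + Finsupp.single p.1 n :
          G →₀ ULift.{u} ℤ) :=
      groupHomology.d₂₁_single (A := intRep G) p n
    refine Eq.trans ?_ (congrArg _ e).symm
    rw [evalChain_single, map_add, map_sub]
    simp only [Finsupp.liftAddHom_apply_single, smul_add, smul_sub]
    rfl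

/-- A coboundary vanishes on cycles. -/
theorem evalChain_coboundary (f : G × G → A)
    (hf : f ∈ groupCohomology.coboundaries₂ (coeffRep G A))
    (z : G × G →₀ ULift.{u} ℤ) (hz : z ∈ groupHomology.cycles₂ (intRep G)) :
    evalChain f z = 0 := by
  obtain ⟨x, rfl⟩ := hf
  have hz' : (groupHomology.d₂₁ (intRep G)).hom z = 0 := hz
  exact (evalChain_d x z).trans ((congrArg _ hz').trans (map_zero _))

/-- The class map from 2-cycles to `H₂(G)`. -/
noncomputable def cycleClass (G : Type u) [Group G] :
    groupHomology.cycles₂ (intRep G) →+ HTwo G :=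
  (groupHomology.H2π (intRep G)).hom.toAddMonoidHom

theorem cycleClass_surjective (G : Type u) [Group G] :
    Function.Surjective (cycleClass G) :=
  fun x => groupHomology.H2_induction_on x fun z => ⟨z, rfl⟩

theorem cycleClass_eq_zero (z : groupHomology.cycles₂ (intRep G)) :
    cycleClass G z = 0 ↔ z.1 ∈ groupHomology.boundaries₂ (intRep G) :=
  groupHomology.H2π_eq_zero_iff z

/-- The class map from 2-cocycles to `H²(G, A)`. -/
noncomputable def cocycleClass (G A : Type u) [Group G] [AddCommGroup A] :
    groupCohomology.cocycles₂ (coeffRep G A) →+ CoHTwo G A :=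
  (groupCohomology.H2π (coeffRep G A)).hom.toAddMonoidHom

theorem cocycleClass_surjective (G A : Type u) [Group G] [AddCommGroup A] :
    Function.Surjective (cocycleClass G A) :=
  fun x => groupCohomology.H2_induction_on x fun z => ⟨z, rfl⟩

theorem cocycleClass_eq_zero (f : groupCohomology.cocycles₂ (coeffRep G A)) :
    cocycleClass G A f = 0 ↔
      (f : G × G → A) ∈ groupCohomology.coboundaries₂ (coeffRep G A) :=
  groupCohomology.H2π_eq_zero_iff f

/-- The homomorphism `H₂(G) → A` induced by a 2-cocycle. -/
noncomputable def evalHTwo (f : groupCohomology.cocycles₂ (coeffRep G A)) : HTwo G →+ A :=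
  (cycleClass G).liftOfSurjective (cycleClass_surjective G)
    ⟨(evalChain (f : G × G → A)).comp
        (groupHomology.cycles₂ (intRep G)).subtype.toAddMonoidHom,
      fun z hz => evalChain_boundary f z.1 ((cycleClass_eq_zero z).1 hz)⟩

theorem evalHTwo_cycleClass (f : groupCohomology.cocycles₂ (coeffRep G A))
    (z : groupHomology.cycles₂ (intRep G)) :
    evalHTwo f (cycleClass G z) = evalChain (f : G × G → A) z.1 :=
  (cycleClass G).liftOfRightInverse_comp_apply _ _ _ z

/-- The universal coefficient map `H²(G, A) → Hom(H₂(G), A)`, sending the class of a 2-cocycle `f`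
to the homomorphism `[∑ nᵢ (gᵢ, hᵢ)] ↦ ∑ nᵢ f (gᵢ, hᵢ)`. -/
noncomputable def universalCoefficientMap (G A : Type u) [Group G] [AddCommGroup A] :
    CoHTwo G A →+ (HTwo G →+ A) :=
  (cocycleClass G A).liftOfSurjective (cocycleClass_surjective G A)
    ⟨{ toFun := evalHTwo
       map_zero' := by
        ext x
        obtain ⟨z, rfl⟩ := cycleClass_surjective G x
        rw [evalHTwo_cycleClass]
        exact evalChain_coboundary _ (Submodule.zero_mem _) z.1 z.2
       map_add' := fun f f' => by
        ext x
        obtain ⟨z, rfl⟩ := cycleClass_surjective G x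
        rw [AddMonoidHom.add_apply, evalHTwo_cycleClass, evalHTwo_cycleClass,
          evalHTwo_cycleClass]
        exact evalChain_add _ _ z.1 },
      fun f hf => by
        rw [AddMonoidHom.mem_ker]
        ext x
        obtain ⟨z, rfl⟩ := cycleClass_surjective G x
        exact (evalHTwo_cycleClass f z).trans
          (evalChain_coboundary _ ((cocycleClass_eq_zero f).1 hf) z.1 z.2)⟩

theorem universalCoefficientMap_apply (f : groupCohomology.cocycles₂ (coeffRep G A))
    (z : groupHomology.cycles₂ (intRep G)) :
    universalCoefficientMap G A (cocycleClass G A f) (cycleClass G z) =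
      evalChain (f : G × G → A) z.1 :=
  (DFunLike.congr_fun ((cocycleClass G A).liftOfRightInverse_comp_apply _ _ _ f) _).trans
    (evalHTwo_cycleClass f z)

end UniversalCoefficient

/-- The extension `1 → N → E → G → 1` is central. -/
def IsCentral {N E G : Type*} [Group N] [Group E] [Group G] (e : GroupExtension N E G) : Prop :=
  e.inl.range ≤ Subgroup.center E

section ExtensionClass

variable {G A E : Type u} [Group G] [AddCommGroup A] [Group E]
  (e : GroupExtension (Multiplicative A) E G)

theorem factorSet_exists (σ : e.Section) (p : G × G) :
    ∃ a : A, e.inl (Multiplicative.ofAdd a) = σ p.1 * σ p.2 * (σ (p.1 * p.2))⁻¹ := by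
  have h : σ p.1 * σ p.2 * (σ (p.1 * p.2))⁻¹ ∈ e.inl.range := by
    rw [e.range_inl_eq_ker_rightHom, MonoidHom.mem_ker]
    simp
  obtain ⟨a, ha⟩ := h
  exact ⟨a.toAdd, ha⟩

/-- The factor set of an extension `e` with respect to a set-theoretic section `σ`:
the function `f` with `σ(g) σ(h) = f(g, h) σ(gh)`. -/
noncomputable def factorSet (σ : e.Section) (p : G × G) : A :=
  (factorSet_exists e σ p).choose

theorem factorSet_spec (σ : e.Section) (g h : G) :
    e.inl (Multiplicative.ofAdd (factorSet e σ (g, h))) * σ (g * h) = σ g * σ h := by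
  have := (factorSet_exists e σ (g, h)).choose_spec
  unfold factorSet
  rw [this]
  group

theorem inl_comm (he : IsCentral e) (a : A) (x : E) :
    x * e.inl (Multiplicative.ofAdd a) = e.inl (Multiplicative.ofAdd a) * x :=
  Subgroup.mem_center_iff.1 (he ⟨_, rfl⟩) x

/-- The factor set of a central extension is a 2-cocycle. -/
noncomputable def factorCocycle (he : IsCentral e) (σ : e.Section) :
    groupCohomology.cocycles₂ (coeffRep G A) :=
  ⟨factorSet e σ, (groupCohomology.mem_cocycles₂_iff (A := coeffRep G A) _).2 fun g h j => by
    change factorSet e σ (g * h, j) + factorSet e σ (g, h) =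
      factorSet e σ (h, j) + factorSet e σ (g, h * j)
    apply Multiplicative.ofAdd.injective
    apply e.inl_injective
    rw [ofAdd_add, ofAdd_add, map_mul, map_mul]
    have c := inl_comm e he
    apply mul_right_cancel (b := σ (g * h * j))
    calc e.inl (Multiplicative.ofAdd (factorSet e σ (g * h, j))) *
          e.inl (Multiplicative.ofAdd (factorSet e σ (g, h))) * σ (g * h * j)
        = e.inl (Multiplicative.ofAdd (factorSet e σ (g, h))) *
          (e.inl (Multiplicative.ofAdd (factorSet e σ (g * h, j))) * σ (g * h * j)) := by
          rw [c, mul_assoc]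
      _ = σ g * (σ h * σ j) := by
          rw [factorSet_spec, ← mul_assoc, factorSet_spec, mul_assoc]
      _ = e.inl (Multiplicative.ofAdd (factorSet e σ (h, j))) * (σ g * σ (h * j)) := by
          rw [← factorSet_spec e σ h j, ← mul_assoc, c, mul_assoc]
      _ = _ := by
          rw [← factorSet_spec e σ g (h * j), mul_assoc, mul_assoc g h j]⟩

/-- The class in `H²(G, A)` of a central extension of `G` by `A`. -/
noncomputable def extensionClass (he : IsCentral e) : CoHTwo G A :=
  cocycleClass G A (factorCocycle e he e.surjInvRightHom)

/-- The class of a central extension does not depend on the section. -/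
theorem extensionClass_eq (he : IsCentral e) (σ : e.Section) :
    extensionClass e he = cocycleClass G A (factorCocycle e he σ) := by
  have hx : ∀ g : G, ∃ a : A,
      e.inl (Multiplicative.ofAdd a) * σ g = e.surjInvRightHom g := by
    intro g
    have h : e.surjInvRightHom g * (σ g)⁻¹ ∈ e.inl.range := by
      rw [e.range_inl_eq_ker_rightHom, MonoidHom.mem_ker]
      simp
    obtain ⟨a, ha⟩ := h
    exact ⟨a.toAdd, by rw [ofAdd_toAdd, ha, inv_mul_cancel_right]⟩
  choose x hx using hx
  unfold extensionClass
  rw [← sub_eq_zero, ← map_sub, cocycleClass_eq_zero]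
  refine ⟨x, funext fun p => ?_⟩
  obtain ⟨g, h⟩ := p
  change x h - x (g * h) + x g =
    factorSet e e.surjInvRightHom (g, h) - factorSet e σ (g, h)
  have c := inl_comm e he
  have key : x g + x h + factorSet e σ (g, h) =
      factorSet e e.surjInvRightHom (g, h) + x (g * h) := by
    apply Multiplicative.ofAdd.injective
    apply e.inl_injective
    rw [ofAdd_add, ofAdd_add, ofAdd_add, map_mul, map_mul, map_mul]
    apply mul_right_cancel (b := σ (g * h))
    rw [mul_assoc, factorSet_spec, mul_assoc _ _ (σ (g * h)), hx, factorSet_spec, ← hx g, ← hx h]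
    rw [mul_assoc, mul_assoc, ← mul_assoc (σ g), c]
    simp only [mul_assoc]
  rw [eq_sub_iff_add_eq, ← sub_eq_zero]
  rw [← sub_eq_zero] at key
  rw [← key]
  abel

end ExtensionClass

/-- `(ϑ, Θ)` is a morphism of extensions of `G` over the identity of `G`. -/
def IsExtMorphism {G B U A E : Type u} [Group G] [AddCommGroup B] [Group U] [AddCommGroup A]
    [Group E] (c : GroupExtension (Multiplicative B) U G)
    (e : GroupExtension (Multiplicative A) E G) (ϑ : B →+ A) (Θ : U →* E) : Prop :=
  (∀ b : B, Θ (c.inl (Multiplicative.ofAdd b)) = e.inl (Multiplicative.ofAdd (ϑ b))) ∧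
    ∀ x : U, e.rightHom (Θ x) = c.rightHom x

/-- The central extension `0 → H₂(G) → U → G → 1` is universal: every central extension
`0 → A → E → G → 1` receives a morphism `(ϑ, Θ, id)` from it, and the component
`ϑ : H₂(G) → A` of every such morphism is the image of the class of the extension under the
universal coefficient map `H²(G, A) → Hom(H₂(G), A)`. -/
def IsUniversal {G U : Type u} [Group G] [Group U]
    (c : GroupExtension (Multiplicative (HTwo G)) U G) : Prop :=
  IsCentral c ∧
    ∀ (A E : Type u) [AddCommGroup A] [Group E] (e : GroupExtension (Multiplicative A) E G)
      (he : IsCentral e),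
      (∃ (ϑ : HTwo G →+ A) (Θ : U →* E), IsExtMorphism c e ϑ Θ) ∧
        ∀ (ϑ : HTwo G →+ A) (Θ : U →* E), IsExtMorphism c e ϑ Θ →
          ϑ = universalCoefficientMap G A (extensionClass e he)

end CentralExt

/-- The relators of the standard presentation of the braid group on `n` strings. The generator
`σ_{i+1}` is indexed by `i : Fin (n - 1)`. -/
def braidRels (n : ℕ) : Set (FreeGroup (Fin (n - 1))) :=
  {r | ∃ i j : Fin (n - 1), i.val + 2 ≤ j.val ∧
      r = FreeGroup.of i * FreeGroup.of j * (FreeGroup.of i)⁻¹ * (FreeGroup.of j)⁻¹} ∪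
    {r | ∃ i j : Fin (n - 1), i.val + 1 = j.val ∧
      r = FreeGroup.of i * FreeGroup.of j * FreeGroup.of i *
        (FreeGroup.of j)⁻¹ * (FreeGroup.of i)⁻¹ * (FreeGroup.of j)⁻¹}

/-- Artin's braid group `B_n` on `n` strings. -/
abbrev BraidGroup (n : ℕ) : Type := PresentedGroup (braidRels n)

/-- The Artin generators of the braid group. -/
def braidGen {n : ℕ} (j : Fin (n - 1)) : BraidGroup n := PresentedGroup.of j

/-! By the Peiffer identity the kernel `K` of `∂` is central, and `∂` is onto because its image is
normal and contains `S`. So `C` is a central extension `k` of `G` by `K`. Conversely every central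
extension `e` of `G` is a crossed module, so freeness lifts the identity of `G` to a morphism `k →
e`. Let `t : H₂(G) → K` be the image of the class of `k` under the universal coefficient map. By
naturality, a morphism `k → e` with component `ϑ` gives `ϑ ∘ t` as the image of the class of `e`.
Everything then reduces to `t` being bijective. Injective: `t` is a factor of every such image, and
for the extension by 2-chains modulo 2-boundaries the image is the inclusion of cycles modulo
boundaries (`exists_extension_universalCoefficientMap_injective`). Surjective: the image of `t`
contains `K ∩ [C, C]`, part of the five-term exact sequence (`mem_range_of_inl_mem_commutator`), and
injectivity of `C_Ab → G_Ab` gives `K ≤ [C, C]`. For braid groups, the generators are all conjugate,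
and the exponent sum together with the uniqueness clause of freeness gives `K ≤ [C, C]`. -/

namespace CentralExt

/-! ### The central extension defined by a 2-cocycle. -/

section CocycleExtension

variable {G A : Type u} [Group G] [AddCommGroup A]

/-- The underlying set `A × G` of the central extension defined by the 2-cocycle `f`. -/
@[ext]
structure CocycleExtension (f : groupCohomology.cocycles₂ (coeffRep G A)) : Type u where
  fiber : A
  base : G

theorem cocycle_add (f : groupCohomology.cocycles₂ (coeffRep G A)) (g h j : G) :
    f (g * h, j) + f (g, h) = (f (h, j) + f (g, h * j) : A) :=
  (groupCohomology.mem_cocycles₂_iff (A := coeffRep G A) f.1).1 f.2 g h j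

theorem cocycle_one_left (f : groupCohomology.cocycles₂ (coeffRep G A)) (g : G) :
    (f (1, g) : A) = f (1, 1) :=
  groupCohomology.cocycles₂_map_one_fst f g

theorem cocycle_one_right (f : groupCohomology.cocycles₂ (coeffRep G A)) (g : G) :
    (f (g, 1) : A) = f (1, 1) := by
  have h := cocycle_add f g 1 1
  rw [mul_one, mul_one] at h
  exact add_right_cancel h

namespace CocycleExtension

variable (f : groupCohomology.cocycles₂ (coeffRep G A))

noncomputable instance : Mul (CocycleExtension f) :=
  ⟨fun x y => ⟨x.fiber + y.fiber + f (x.base, y.base), x.base * y.base⟩⟩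

/-- Cocycles are not normalized, hence the corrections by `f (1, 1)` in the unit, the inverse and
the inclusion of `A`. -/
noncomputable instance : One (CocycleExtension f) :=
  ⟨⟨-(f (1, 1) : A), 1⟩⟩

noncomputable instance : Inv (CocycleExtension f) :=
  ⟨fun x => ⟨-x.fiber - (f (x.base⁻¹, x.base) : A) - (f (1, 1) : A), x.base⁻¹⟩⟩

theorem fiber_mul (x y : CocycleExtension f) :
    (x * y).fiber = x.fiber + y.fiber + f (x.base, y.base) := rfl

theorem base_mul (x y : CocycleExtension f) : (x * y).base = x.base * y.base := rfl

theorem fiber_one : (1 : CocycleExtension f).fiber = -(f (1, 1) : A) := rfl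

theorem base_one : (1 : CocycleExtension f).base = 1 := rfl

theorem fiber_inv (x : CocycleExtension f) :
    x⁻¹.fiber = -x.fiber - (f (x.base⁻¹, x.base) : A) - (f (1, 1) : A) := rfl

theorem base_inv (x : CocycleExtension f) : x⁻¹.base = x.base⁻¹ := rfl

noncomputable instance : Group (CocycleExtension f) :=
  Group.ofLeftAxioms
    (fun x y z => by
      ext
      · simp only [fiber_mul, base_mul]
        have h := cocycle_add f x.base y.base z.base
        calc _ = x.fiber + y.fiber + z.fiber +
              ((f (x.base * y.base, z.base) : A) + f (x.base, y.base)) := by abel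
          _ = _ := by rw [h]; abel
      · exact mul_assoc _ _ _)
    (fun x => by
      ext
      · simp only [fiber_mul, fiber_one, base_one, cocycle_one_left f x.base]
        abel
      · exact one_mul _)
    (fun x => by
      ext
      · simp only [fiber_mul, fiber_inv, base_inv, fiber_one]
        abel
      · exact inv_mul_cancel _)

/-- The central extension of `G` by `A` defined by a 2-cocycle. -/
noncomputable def extension : GroupExtension (Multiplicative A) (CocycleExtension f) G where
  inl :=
    { toFun := fun a => ⟨a.toAdd - (f (1, 1) : A), 1⟩
      map_one' := by
        ext
        · simp only [fiber_one, toAdd_one, zero_sub]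
        · rfl
      map_mul' := fun a b => by
        ext
        · simp only [fiber_mul, toAdd_mul]
          abel
        · exact (mul_one _).symm }
  rightHom :=
    { toFun := base
      map_one' := rfl
      map_mul' := fun _ _ => rfl }
  inl_injective a b h := by
    have h' := congrArg fiber h
    exact Multiplicative.toAdd.injective (sub_left_injective h')
  range_inl_eq_ker_rightHom := by
    ext x
    constructor
    · rintro ⟨a, rfl⟩
      rfl
    · intro hx
      refine ⟨Multiplicative.ofAdd (x.fiber + (f (1, 1) : A)), ?_⟩
      ext
      · exact add_sub_cancel_right _ _
      · exact (show x.base = 1 from hx).symm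
  rightHom_surjective g := ⟨⟨0, g⟩, rfl⟩

theorem extension_isCentral : IsCentral (extension f) := by
  rintro _ ⟨a, rfl⟩
  refine Subgroup.mem_center_iff.2 fun x => ?_
  ext
  · change x.fiber + (a.toAdd - (f (1, 1) : A)) + (f (x.base, 1) : A) =
      (a.toAdd - (f (1, 1) : A)) + x.fiber + (f (1, x.base) : A)
    rw [cocycle_one_left f x.base, cocycle_one_right f x.base]
    abel
  · exact (mul_one x.base).trans (one_mul x.base).symm

/-- The section `g ↦ (0, g)`. -/
noncomputable def stdSection : (extension f).Section where
  toFun g := ⟨0, g⟩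
  rightInverse_rightHom _ := rfl

theorem factorSet_stdSection (p : G × G) :
    factorSet (extension f) (stdSection f) p = f p := by
  have h := congrArg fiber (factorSet_spec (extension f) (stdSection f) p.1 p.2)
  change factorSet (extension f) (stdSection f) p - (f (1, 1) : A) + 0 +
    (f (1, p.1 * p.2) : A) = 0 + 0 + f p at h
  rw [cocycle_one_left f (p.1 * p.2)] at h
  simpa using h

end CocycleExtension

end CocycleExtension

/-! ### Evaluation of cochains on bar chains. -/

section Eval

variable {G A : Type u} [AddCommGroup A]

theorem map_evalChain {B : Type u} [AddCommGroup B] (ϑ : A →+ B) (f : G × G → A)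
    (z : G × G →₀ ULift.{u} ℤ) : ϑ (evalChain f z) = evalChain (fun p => ϑ (f p)) z := by
  induction z using Finsupp.induction_linear with
  | zero => simp
  | add x y hx hy => rw [map_add, map_add, map_add, hx, hy]
  | single p n => simp [evalChain_single]

/-- Identifies the map on `H₂(G)` induced by the tautological cocycle with reduction of cycles
modulo boundaries. -/
theorem evalChain_mk (N : AddSubgroup (G × G →₀ ULift.{u} ℤ)) (z : G × G →₀ ULift.{u} ℤ) :
    evalChain (fun p => (QuotientAddGroup.mk (Finsupp.single p (ULift.up 1)) :
      (G × G →₀ ULift.{u} ℤ) ⧸ N)) z = QuotientAddGroup.mk z := by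
  induction z using Finsupp.induction_linear with
  | zero => rw [map_zero]; rfl
  | add x y hx hy => rw [map_add, hx, hy]; rfl
  | single p n =>
    rw [evalChain_single]
    refine (QuotientAddGroup.mk_zsmul N _ n.down).symm.trans ?_
    rw [Finsupp.smul_single]
    congr 2
    ext
    simp

end Eval

/-! ### The homomorphism `H₂(G) → A` attached to a central extension. -/

section Transgression

variable {G A E : Type u} [Group G] [AddCommGroup A] [Group E]

theorem universalCoefficientMap_extensionClass (e : GroupExtension (Multiplicative A) E G)
    (he : IsCentral e) (σ : e.Section) (z : groupHomology.cycles₂ (intRep G)) :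
    universalCoefficientMap G A (extensionClass e he) (cycleClass G z) =
      evalChain (factorSet e σ) z.1 := by
  rw [extensionClass_eq e he σ]
  exact universalCoefficientMap_apply _ z

/-- Naturality of the image of the class under the universal coefficient map. -/
theorem IsExtMorphism.universalCoefficientMap_extensionClass_eq {B F : Type u} [AddCommGroup B]
    [Group F]
    {c : GroupExtension (Multiplicative A) E G} {e : GroupExtension (Multiplicative B) F G}
    {ϑ : A →+ B} {Θ : E →* F} (h : IsExtMorphism c e ϑ Θ) (hc : IsCentral c) (he : IsCentral e) :
    universalCoefficientMap G B (extensionClass e he) =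
      ϑ.comp (universalCoefficientMap G A (extensionClass c hc)) := by
  let σ := c.surjInvRightHom
  -- Pushing the section forward along `Θ` makes the two factor sets correspond exactly under `ϑ`,
  -- not only up to a coboundary.
  let τ : e.Section := ⟨fun g => Θ (σ g), fun g => by rw [h.2]; exact σ.rightHom_section g⟩
  have hτ : factorSet e τ = fun p => ϑ (factorSet c σ p) := by
    funext p
    apply Multiplicative.ofAdd.injective
    apply e.inl_injective
    apply mul_right_cancel (b := τ (p.1 * p.2))
    rw [factorSet_spec e τ p.1 p.2, ← h.1]
    change Θ (σ p.1) * Θ (σ p.2) = _ * Θ (σ (p.1 * p.2))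
    rw [← map_mul Θ, ← map_mul Θ, factorSet_spec]
  ext x
  obtain ⟨z, rfl⟩ := cycleClass_surjective G x
  rw [AddMonoidHom.comp_apply, universalCoefficientMap_extensionClass e he τ,
    universalCoefficientMap_extensionClass c hc σ, map_evalChain, hτ]

variable (G) in
/-- The tautological 2-cocycle with values in 2-chains modulo 2-boundaries. -/
noncomputable def tautologicalCocycle :
    groupCohomology.cocycles₂ (coeffRep G ((G × G →₀ ULift.{u} ℤ) ⧸
      (groupHomology.boundaries₂ (intRep G)).toAddSubgroup)) :=
  ⟨fun p => QuotientAddGroup.mk (Finsupp.single p (ULift.up 1)),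
    (groupCohomology.mem_cocycles₂_def (A := coeffRep G _) _).2 fun g h j => by
      refine (QuotientAddGroup.eq_zero_iff (N := (groupHomology.boundaries₂
        (intRep G)).toAddSubgroup) (Finsupp.single (h, j) (ULift.up 1) -
        Finsupp.single (g * h, j) (ULift.up 1) + Finsupp.single (g, h * j) (ULift.up 1) -
        Finsupp.single (g, h) (ULift.up 1))).2 ?_
      exact ⟨Finsupp.single (g, h, j) (ULift.up 1),
        groupHomology.d₃₂_single (A := intRep G) (g, h, j) (ULift.up 1)⟩⟩

variable (G) in
/-- Some central extension has a class with injective image under the universal coefficient map. -/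
theorem exists_extension_universalCoefficientMap_injective :
    ∃ (A E : Type u) (_ : AddCommGroup A) (_ : Group E)
      (e : GroupExtension (Multiplicative A) E G) (he : IsCentral e),
      Function.Injective (universalCoefficientMap G A (extensionClass e he)) := by
  let f := tautologicalCocycle G
  refine ⟨_, _, _, _, CocycleExtension.extension f, CocycleExtension.extension_isCentral f, ?_⟩
  rw [injective_iff_map_eq_zero]
  intro x hx
  obtain ⟨z, rfl⟩ := cycleClass_surjective G x
  rw [universalCoefficientMap_extensionClass _ _ (CocycleExtension.stdSection f),
    funext (CocycleExtension.factorSet_stdSection f)] at hx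
  rw [cycleClass_eq_zero]
  exact (QuotientAddGroup.eq_zero_iff z.1).1 ((evalChain_mk _ z.1).symm.trans hx)

/-- For a central extension `e` of `G` by `A`, the elements of `A` that are products of commutators
in the extension lie in the image of `H₂(G)`. -/
theorem mem_range_of_inl_mem_commutator (e : GroupExtension (Multiplicative A) E G)
    (he : IsCentral e) (a : A) (ha : e.inl (Multiplicative.ofAdd a) ∈ commutator E) :
    a ∈ (universalCoefficientMap G A (extensionClass e he)).range := by
  let σ := e.surjInvRightHom
  -- `κ x` is the `A`-coordinate of `x` relative to `σ`; it is additive up to the factor set.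
  have hκ : ∀ x : E, ∃ a : A, e.inl (Multiplicative.ofAdd a) * σ (e.rightHom x) = x := by
    intro x
    have h : x * (σ (e.rightHom x))⁻¹ ∈ e.inl.range := by
      rw [e.range_inl_eq_ker_rightHom, MonoidHom.mem_ker]
      simp
    obtain ⟨a, ha⟩ := h
    exact ⟨a.toAdd, by rw [ofAdd_toAdd, ha, inv_mul_cancel_right]⟩
  choose κ hκ using hκ
  have hκ_mul : ∀ x y : E, κ (x * y) = κ x + κ y + factorSet e σ (e.rightHom x, e.rightHom y) := by
    intro x y
    apply Multiplicative.ofAdd.injective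
    apply e.inl_injective
    apply mul_right_cancel (b := σ (e.rightHom (x * y)))
    rw [hκ, ofAdd_add, ofAdd_add, map_mul, map_mul, map_mul, mul_assoc, factorSet_spec]
    conv_lhs => rw [← hκ x, ← hκ y]
    rw [mul_assoc, mul_assoc, ← mul_assoc (σ _), inl_comm e he]
    simp only [mul_assoc]
  let d : (G × G →₀ ULift.{u} ℤ) →+ (G →₀ ULift.{u} ℤ) :=
    (groupHomology.d₂₁ (intRep G)).hom.toAddMonoidHom
  have hd : ∀ g h : G, d (Finsupp.single (g, h) (ULift.up 1)) = Finsupp.single h (ULift.up 1) -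
      Finsupp.single (g * h) (ULift.up 1) + Finsupp.single g (ULift.up 1) := fun g h =>
    groupHomology.d₂₁_single (A := intRep G) (g, h) (ULift.up 1)
  -- Dividing by `(d z, -⟨f, z⟩)` absorbs the failure of both `x ↦ [π x]` and `κ` to be additive, so
  -- `ψ` is a homomorphism to an abelian group and kills commutators.
  let R : AddSubgroup ((G →₀ ULift.{u} ℤ) × A) := (d.prod (-(evalChain (factorSet e σ)))).range
  let ψ : E →* Multiplicative (((G →₀ ULift.{u} ℤ) × A) ⧸ R) :=
    MonoidHom.mk' (fun x => Multiplicative.ofAdd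
      (QuotientAddGroup.mk (s := R) (Finsupp.single (e.rightHom x) (ULift.up 1), κ x))) fun x y => by
        rw [← ofAdd_add, ← QuotientAddGroup.mk_add]
        refine congrArg _ (QuotientAddGroup.eq.2 ⟨Finsupp.single (e.rightHom x, e.rightHom y)
          (ULift.up 1), ?_⟩)
        ext1
        · change d _ = - Finsupp.single _ _ + (Finsupp.single _ _ + Finsupp.single _ _)
          rw [hd, map_mul]
          abel
        · change - evalChain _ _ = - κ (x * y) + (κ x + κ y)
          rw [evalChain_single, hκ_mul, one_smul]
          abel
  have hcomm : commutator E ≤ ψ.ker := by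
    rw [commutator_def, Subgroup.commutator_le]
    intro x _ y _
    rw [MonoidHom.mem_ker, map_commutatorElement, commutatorElement_eq_one_iff_mul_comm]
    exact congrArg Multiplicative.ofAdd (add_comm (ψ x).toAdd (ψ y).toAdd)
  have hψ : ψ (e.inl (Multiplicative.ofAdd a)) = ψ 1 :=
    (MonoidHom.mem_ker.1 (hcomm ha)).trans (map_one ψ).symm
  -- `κ 1` need not vanish, since `σ 1` need not be `1`.
  have h1 : κ (e.inl (Multiplicative.ofAdd a)) = a + κ 1 := by
    apply Multiplicative.ofAdd.injective
    apply e.inl_injective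
    apply mul_right_cancel (b := σ 1)
    have h := hκ (e.inl (Multiplicative.ofAdd a))
    have h' := hκ 1
    rw [e.rightHom_inl] at h
    rw [map_one] at h'
    rw [h, ofAdd_add, map_mul, mul_assoc, h', mul_one]
  -- Now `(0, a)` lies in `R`: it comes from a chain `z` with `d z = 0` and `a = -⟨f, z⟩`, so the
  -- cycle `-z` represents a preimage of `a`.
  obtain ⟨z, hz⟩ := QuotientAddGroup.eq.1 (Multiplicative.ofAdd.injective hψ).symm
  have hz1 : d z = 0 := by
    have := congrArg Prod.fst hz
    refine this.trans ?_
    change - Finsupp.single _ _ + Finsupp.single _ _ = 0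
    rw [e.rightHom_inl, map_one, neg_add_cancel]
  have hz2 : - evalChain (factorSet e σ) z = a := by
    have := congrArg Prod.snd hz
    refine this.trans ?_
    change - κ 1 + κ _ = a
    rw [h1]
    abel
  refine ⟨cycleClass G (-⟨z, hz1⟩), ?_⟩
  rw [map_neg, map_neg, universalCoefficientMap_extensionClass e he σ, hz2]

/-- A homomorphism over `G` between extensions restricts to the kernels. -/
theorem exists_isExtMorphism {B U : Type u} [AddCommGroup B] [Group U] (c : GroupExtension (Multiplicative B) U G)
    (e : GroupExtension (Multiplicative A) E G) (Θ : U →* E)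
    (h : ∀ x, e.rightHom (Θ x) = c.rightHom x) : ∃ ϑ : B →+ A, IsExtMorphism c e ϑ Θ := by
  have hϑ : ∀ b : B, ∃ a : A, e.inl (Multiplicative.ofAdd a) =
      Θ (c.inl (Multiplicative.ofAdd b)) := by
    intro b
    have : Θ (c.inl (Multiplicative.ofAdd b)) ∈ e.inl.range := by
      rw [e.range_inl_eq_ker_rightHom, MonoidHom.mem_ker, h, c.rightHom_inl]
    obtain ⟨a, ha⟩ := this
    exact ⟨a.toAdd, ha⟩
  choose ϑ hϑ using hϑ
  refine ⟨AddMonoidHom.mk' ϑ fun b b' => ?_, fun b => (hϑ b).symm, h⟩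
  apply Multiplicative.ofAdd.injective
  apply e.inl_injective
  rw [hϑ, ofAdd_add, ofAdd_add, map_mul, map_mul, map_mul, hϑ, hϑ]

end Transgression

end CentralExt

/-! ### Crossed modules and central extensions. -/

namespace CrossedModule

open CentralExt

theorem ker_bd_le_center {C G : Type*} [Group C] [Group G] (X : CrossedModule C G) :
    X.bd.ker ≤ Subgroup.center C := by
  intro a ha
  refine Subgroup.mem_center_iff.2 fun b => ?_
  have h := X.peiffer a b
  rw [MonoidHom.mem_ker.1 ha, map_one, MulAut.one_apply] at h
  exact (mul_inv_eq_iff_eq_mul.1 h).symm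

theorem bd_surjective {C G : Type*} [Group C] [Group G] (X : CrossedModule C G)
    {S : Set G} (hS : Subgroup.normalClosure S = ⊤) (h : S ⊆ X.bd.range) :
    Function.Surjective X.bd := by
  have : X.bd.range.Normal := ⟨by
    rintro _ ⟨c, rfl⟩ x
    exact ⟨X.act x c, X.bd_act x c⟩⟩
  exact MonoidHom.range_eq_top.1 (top_le_iff.1 (hS ▸ Subgroup.normalClosure_le_normal h))

/-- The crossed module of a central extension. -/
noncomputable def ofCentralExtension {N E G : Type*} [Group N] [Group E] [Group G]
    (e : GroupExtension N E G) (he : IsCentral e) : CrossedModule E G :=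
  -- Centrality lets conjugation in `E` descend to an action of `G`.
  have hker : e.rightHom.ker ≤ (MulAut.conj : E →* MulAut E).ker := by
    intro x hx
    rw [← e.range_inl_eq_ker_rightHom] at hx
    rw [MonoidHom.mem_ker]
    ext y
    rw [MulAut.conj_apply, ← Subgroup.mem_center_iff.1 (he hx) y, mul_inv_cancel_right]
    rfl
  have hact : ∀ (x y : E), e.rightHom.liftOfSurjective e.rightHom_surjective
      ⟨MulAut.conj, hker⟩ (e.rightHom x) y = x * y * x⁻¹ := fun x y =>
    DFunLike.congr_fun (e.rightHom.liftOfRightInverse_comp_apply _ _ ⟨MulAut.conj, hker⟩ x) y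
  { act := e.rightHom.liftOfSurjective e.rightHom_surjective ⟨MulAut.conj, hker⟩
    bd := e.rightHom
    bd_act := fun x c => by
      obtain ⟨x, rfl⟩ := e.rightHom_surjective x
      rw [hact]
      simp
    peiffer := fun a b => (hact a b).symm }

/-- A crossed module with surjective boundary map is a central extension. -/
theorem exists_groupExtension {C G : Type u} [Group C] [Group G] (X : CrossedModule C G)
    (hX : Function.Surjective X.bd) :
    ∃ (A : Type u) (_ : AddCommGroup A) (e : GroupExtension (Multiplicative A) C G),
      e.rightHom = X.bd ∧ IsCentral e := by
  let _ : CommGroup X.bd.ker :=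
    { (inferInstance : Group X.bd.ker) with
      mul_comm := fun a b => Subtype.ext
        (Subgroup.mem_center_iff.1 (X.ker_bd_le_center b.2) a.1) }
  refine ⟨Additive X.bd.ker, inferInstance,
    { inl :=
        { toFun := fun a => (a.toAdd.toMul : C)
          map_one' := rfl
          map_mul' := fun _ _ => rfl }
      rightHom := X.bd
      inl_injective := fun a b h => Subtype.ext h
      range_inl_eq_ker_rightHom := ?_
      rightHom_surjective := hX }, rfl, ?_⟩
  · ext x
    exact ⟨fun ⟨a, ha⟩ => ha ▸ Subtype.prop _, fun hx => ⟨Multiplicative.ofAdd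
      (Additive.ofMul ⟨x, hx⟩), rfl⟩⟩
  · rintro _ ⟨a, rfl⟩
    exact X.ker_bd_le_center (Subtype.prop _)

variable {C G Y : Type u} [Group C] [Group G] {X : CrossedModule C G} {φ : Y → C}

/-- Freeness is applied over the identity of `G` to the crossed module of `e`, with arbitrary lifts
of the `∂ φ(y)` as images of the generators. -/
theorem IsFreeOn.exists_hom_extension (hfree : X.IsFreeOn φ) {A E : Type u} [AddCommGroup A]
    [Group E] (e : GroupExtension (Multiplicative A) E G) (he : IsCentral e) :
    ∃ Θ : C →* E, ∀ c, e.rightHom (Θ c) = X.bd c := by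
  obtain ⟨Θ, ⟨-, h, -⟩, -⟩ := hfree E G (ofCentralExtension e he) (MonoidHom.id G)
    (fun y => Function.surjInv e.rightHom_surjective (X.bd (φ y)))
    (fun y => (Function.surjInv_eq e.rightHom_surjective _).symm)
  exact ⟨Θ, h⟩

/-- A free crossed module with surjective boundary map whose kernel consists of products of
commutators is a universal central extension. -/
theorem IsFreeOn.exists_isUniversal (hfree : X.IsFreeOn φ) (hX : Function.Surjective X.bd)
    (hker : X.bd.ker ≤ commutator C) :
    ∃ c : GroupExtension (Multiplicative (HTwo G)) C G, c.rightHom = X.bd ∧ IsUniversal c := by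
  obtain ⟨K, _, k, hk, hkc⟩ := X.exists_groupExtension hX
  let t := universalCoefficientMap G K (extensionClass k hkc)
  have lift : ∀ {A E : Type u} [AddCommGroup A] [Group E]
      (e : GroupExtension (Multiplicative A) E G), IsCentral e →
      ∃ (ϑ : K →+ A) (Θ : C →* E), IsExtMorphism k e ϑ Θ := by
    intro A E _ _ e he
    obtain ⟨Θ, hΘ⟩ := hfree.exists_hom_extension e he
    obtain ⟨ϑ, h⟩ := exists_isExtMorphism k e Θ (by rwa [hk])
    exact ⟨ϑ, Θ, h⟩
  have ht_inj : Function.Injective t := by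
    obtain ⟨A, E, _, _, e, he, hinj⟩ := exists_extension_universalCoefficientMap_injective G
    obtain ⟨ϑ, Θ, h⟩ := lift e he
    rw [h.universalCoefficientMap_extensionClass_eq hkc he, AddMonoidHom.coe_comp] at hinj
    exact hinj.of_comp
  have ht_surj : Function.Surjective t := fun a => by
    refine mem_range_of_inl_mem_commutator k hkc a (hker ?_)
    rw [MonoidHom.mem_ker, ← hk, k.rightHom_inl]
  have hrange : (k.inl.comp (AddMonoidHom.toMultiplicative t)).range = k.inl.range := by
    rw [MonoidHom.range_comp, MonoidHom.range_eq_top.2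
      (show Function.Surjective (AddMonoidHom.toMultiplicative t) from ht_surj),
      MonoidHom.range_eq_map]
  -- The extension `k` with its kernel `K` renamed to `H₂(G)` through `t`.
  let c : GroupExtension (Multiplicative (HTwo G)) C G :=
    { inl := k.inl.comp (AddMonoidHom.toMultiplicative t)
      rightHom := k.rightHom
      inl_injective := k.inl_injective.comp ht_inj
      range_inl_eq_ker_rightHom := hrange.trans k.range_inl_eq_ker_rightHom
      rightHom_surjective := k.rightHom_surjective }
  refine ⟨c, hk, hrange.trans_le hkc, fun A E _ _ e he => ⟨?_, fun ϑ Θ h => ?_⟩⟩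
  · obtain ⟨ϑ, Θ, h⟩ := lift e he
    exact ⟨ϑ.comp t, Θ, fun b => h.1 (t b), h.2⟩
  -- The same `Θ` is a morphism out of `k` with some component `ϑ'`; comparing on the kernel gives
  -- `ϑ = ϑ' ∘ t`.
  · obtain ⟨ϑ', h'⟩ := exists_isExtMorphism k e Θ h.2
    rw [h'.universalCoefficientMap_extensionClass_eq hkc he]
    ext b
    apply Multiplicative.ofAdd.injective
    apply e.inl_injective
    rw [← h.1 b]
    exact h'.1 (t b)

/-- If a homomorphism `ε : G → ℤ` sends the boundary of the single free generator to `1`, then the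
kernel of the boundary map consists of products of commutators. -/
theorem IsFreeOn.ker_bd_le_commutator {r : C} (hfree : X.IsFreeOn fun _ : PUnit.{u + 1} => r)
    (hX : Function.Surjective X.bd) (ε : G →* Multiplicative ℤ)
    (hε : ε (X.bd r) = Multiplicative.ofAdd 1) : X.bd.ker ≤ commutator C := by
  let T : CrossedModule (Abelianization C) PUnit.{u + 1} :=
    { act := 1
      bd := 1
      bd_act := fun _ _ => rfl
      peiffer := fun a b => by
        rw [mul_comm a b, mul_inv_cancel_right]
        rfl }
  let β : C →* Abelianization C :=
    (zpowersHom (Abelianization C) (Abelianization.of r)).comp (ε.comp X.bd)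
  have hβ_apply : ∀ c, β c = zpowersHom _ (Abelianization.of r) (ε (X.bd c)) := fun _ => rfl
  -- Both maps send `r` to its class and are morphisms to the crossed module `C_Ab → 1`, so
  -- uniqueness identifies them; `β` factors through `∂`, hence kills its kernel.
  have hβ : Abelianization.of = β := by
    refine (hfree _ _ T 1 (fun _ => Abelianization.of r) fun _ => rfl).unique
      ⟨fun _ => rfl, fun _ => rfl, fun x c => ?_⟩ ⟨fun _ => ?_, fun _ => rfl, fun x c => ?_⟩
    -- Since `∂` is onto, `G` acts on `C` by inner automorphisms, hence trivially on `C_Ab`.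
    · obtain ⟨d, rfl⟩ := hX x
      rw [← X.peiffer, map_mul, map_mul, map_inv, mul_comm (Abelianization.of d),
        mul_inv_cancel_right]
      rfl
    · simp [β, hε]
    · change β (X.act x c) = β c
      rw [hβ_apply, hβ_apply, X.bd_act, map_mul ε, map_mul ε, map_inv, mul_comm (ε x),
        mul_inv_cancel_right]
  intro c hc
  rw [← Abelianization.ker_of, MonoidHom.mem_ker, hβ, hβ_apply, MonoidHom.mem_ker.1 hc, map_one, map_one]

end CrossedModule

/-! ### Braid groups: conjugacy of the generators and exponent sum. -/

section Braid

variable {n : ℕ}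

theorem braidGen_braid (i j : Fin (n - 1)) (h : i.val + 1 = j.val) :
    braidGen i * braidGen j * braidGen i = braidGen j * braidGen i * braidGen j := by
  have hr : (PresentedGroup.mk (braidRels n) (FreeGroup.of i * FreeGroup.of j * FreeGroup.of i *
      (FreeGroup.of j)⁻¹ * (FreeGroup.of i)⁻¹ * (FreeGroup.of j)⁻¹)) = 1 :=
    PresentedGroup.one_of_mem (Or.inr ⟨i, j, h, rfl⟩)
  simp only [map_mul, map_inv] at hr
  have hr' : braidGen i * braidGen j * braidGen i * (braidGen j)⁻¹ * (braidGen i)⁻¹ *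
    (braidGen j)⁻¹ = 1 := hr
  rw [mul_inv_eq_one, mul_inv_eq_iff_eq_mul, mul_inv_eq_iff_eq_mul] at hr'
  exact hr'

/-- The braid relation reads `(σᵢσⱼ) σᵢ = σⱼ (σᵢσⱼ)`. -/
theorem isConj_braidGen_succ (i j : Fin (n - 1)) (h : i.val + 1 = j.val) :
    IsConj (braidGen i) (braidGen j) := by
  refine isConj_iff.2 ⟨braidGen i * braidGen j, ?_⟩
  rw [braidGen_braid i j h, mul_inv_eq_iff_eq_mul, mul_assoc]

theorem isConj_braidGen (i j : Fin (n - 1)) : IsConj (braidGen i) (braidGen j) := by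
  have aux : ∀ (m : ℕ) (i j : Fin (n - 1)), i.val + m = j.val →
      IsConj (braidGen i) (braidGen j) := by
    intro m
    induction m with
    | zero =>
      intro i j h
      rw [Fin.ext (show i.val = j.val from h)]
    | succ m ih =>
      intro i j h
      let k : Fin (n - 1) := ⟨i.val + m, by have := j.isLt; omega⟩
      exact (ih i k rfl).trans (isConj_braidGen_succ k j (by simp only [k]; omega))
  rcases le_total i j with h | h
  · exact aux (j.val - i.val) i j (by have : i.val ≤ j.val := h; omega)
  · exact (aux (i.val - j.val) j i (by have : j.val ≤ i.val := h; omega)).symm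

theorem normalClosure_braidGen (j : Fin (n - 1)) :
    Subgroup.normalClosure {braidGen j} = ⊤ := by
  rw [eq_top_iff, ← PresentedGroup.closure_range_of, Subgroup.closure_le]
  rintro _ ⟨i, rfl⟩
  obtain ⟨c, hc⟩ := isConj_iff.1 (isConj_braidGen j i)
  have h := (Subgroup.normalClosure_normal (s := {braidGen j})).conj_mem _
    (Subgroup.subset_normalClosure (Set.mem_singleton _)) c
  rwa [hc] at h

/-- The exponent sum on the braid group. -/
def braidExponentSum (n : ℕ) : BraidGroup n →* Multiplicative ℤ :=
  PresentedGroup.toGroup (f := fun _ => Multiplicative.ofAdd 1) <| by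
    rintro _ (⟨i, j, -, rfl⟩ | ⟨i, j, -, rfl⟩) <;> simp

end Braid

/-- An element of the kernel has trivial image in `G_Ab`, hence trivial class in `C_Ab`. -/
theorem Abelianization.ker_le_commutator_of_map_injective {C G : Type*} [Group C] [Group G]
    (f : C →* G) (h : Function.Injective (Abelianization.map f)) : f.ker ≤ commutator C := by
  intro c hc
  rw [← Abelianization.ker_of, MonoidHom.mem_ker]
  apply h
  rw [Abelianization.map_of, MonoidHom.mem_ker.1 hc, map_one, map_one]

theorem theorem7p1 :
    (∀ (G C : Type u) [Group G] [Group C] (S : Set G) (X : CrossedModule C G) (φ : S → C),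
      Subgroup.normalClosure S = ⊤ →
      (∀ s : S, X.bd (φ s) = (s : G)) →
      X.IsFreeOn φ →
      Function.Bijective (Abelianization.map X.bd) →
      ∃ c : GroupExtension (Multiplicative (CentralExt.HTwo G)) C G,
        c.rightHom = X.bd ∧ CentralExt.IsUniversal c) ∧
    (∀ (n : ℕ) (j : Fin (n - 1)) (C : Type) [Group C] (X : CrossedModule C (BraidGroup n))
      (r : C),
      X.bd r = braidGen j →
      X.IsFreeOn (fun _ : Unit => r) →
      ∃ c : GroupExtension (Multiplicative (CentralExt.HTwo (BraidGroup n))) C (BraidGroup n),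
        c.rightHom = X.bd ∧ CentralExt.IsUniversal c) := by
  refine ⟨fun G C _ _ S X φ hS hφ hfree hab => ?_, fun n j C _ X r hr hfree => ?_⟩
  · exact hfree.exists_isUniversal (X.bd_surjective hS fun s hs => ⟨φ ⟨s, hs⟩, hφ ⟨s, hs⟩⟩)
      (Abelianization.ker_le_commutator_of_map_injective _ hab.1)
  · have hX := X.bd_surjective (normalClosure_braidGen j) (Set.singleton_subset_iff.2 ⟨r, hr⟩)
    refine hfree.exists_isUniversal hX (hfree.ker_bd_le_commutator hX (braidExponentSum n) ?_)
    rw [hr]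
    exact PresentedGroup.toGroup.of _
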